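/- Let $G$ be a finite simple graph. Its 2-subdivision is obtained by subdividing each edge exactly twice (that is, replacing each edge $uv$ by a path $u,x,y,v$ with two new inner vertices), and its co-2-subdivision $H$ is the complement of the 2-subdivision. For every $\varepsilon>0$ there is a family $(E_x)_{x\in V(H)}$ of ellipses in the Euclidean plane (circles being allowed as ellipses of eccentricity $0$) such that 1. $H$ is the intersection graph of the filled ellipses: for all distinct $x,y\in V(H)$, the vertices $x$ and $y$ are adjacent in $H$ if and only if the filled ellipses bounded by $E_x$ and $E_y$ (each curve together with its interior) intersect; 2. $H$ is also the intersection graph of the hollow ellipses: for all distinct $x,y\in V(H)$, the vertices $x$ and $y$ are adjacent in $H$ if and only if the curves $E_x$ and $E_y$ intersect; 3. every $E_x$ has eccentricity less than $\varepsilon$ and a major axis whose length differs from $1$ by less than $\varepsilon$. -/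

import Mathlib

/-- The Euclidean plane. -/
abbrev Plane : Type := EuclideanSpace ℝ (Fin 2)

/-- The intersection graph of a family of sets: two distinct indices are adjacent when
their sets meet. -/
def intersectionGraph {ι α : Type*} (S : ι → Set α) : SimpleGraph ι where
  Adj i j := i ≠ j ∧ (S i ∩ S j).Nonempty
  symm := ⟨fun _ _ h => ⟨h.1.symm, by rw [Set.inter_comm]; exact h.2⟩⟩
  loopless := ⟨fun _ h => h.1 rfl⟩

/-- The 2-subdivision of `G`: each edge `uv` is replaced by a path `u, x, y, v` with two new
inner vertices. The new vertex next to `u` on this path is the dart `(u, v)`, and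
the new vertex next to `v` is the dart `(v, u)`. -/
def twoSubdivision {V : Type*} (G : SimpleGraph V) : SimpleGraph (V ⊕ G.Dart) where
  Adj
    | Sum.inl _, Sum.inl _ => False
    | Sum.inl v, Sum.inr d => d.fst = v
    | Sum.inr d, Sum.inl v => d.fst = v
    | Sum.inr d, Sum.inr e => e = d.symm
  symm := ⟨by
    rintro (u | d) (v | e) h
    · exact h
    · exact h
    · exact h
    · change e = d.symm at h
      change d = e.symm
      rw [h, SimpleGraph.Dart.symm_symm]⟩
  loopless := ⟨by
    rintro (v | d) h
    · exact h
    · exact d.symm_ne h.symm⟩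

/-- The co-2-subdivision of `G` is the complement of its 2-subdivision. -/
def coTwoSubdivision {V : Type*} (G : SimpleGraph V) : SimpleGraph (V ⊕ G.Dart) :=
  (twoSubdivision G)ᶜ

/-- An ellipse in the plane (circles included), given by its center, a unit vector `dir` spanning
its major axis, and its semi-axes `a ≥ b > 0`. -/
structure Ellipse where
  center : Plane
  dir : Plane
  a : ℝ
  b : ℝ
  norm_dir : ‖dir‖ = 1
  b_pos : 0 < b
  b_le_a : b ≤ a

namespace Ellipse

/-- The coordinate of `p` along the major axis, measured from the center. -/
def majorCoord (E : Ellipse) (p : Plane) : ℝ :=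
  E.dir 0 * (p 0 - E.center 0) + E.dir 1 * (p 1 - E.center 1)

/-- The coordinate of `p` along the minor axis, measured from the center. -/
def minorCoord (E : Ellipse) (p : Plane) : ℝ :=
  E.dir 0 * (p 1 - E.center 1) - E.dir 1 * (p 0 - E.center 0)

/-- The hollow ellipse: the curve, without its interior. -/
def hollow (E : Ellipse) : Set Plane :=
  {p | (E.majorCoord p / E.a) ^ 2 + (E.minorCoord p / E.b) ^ 2 = 1}

/-- The filled ellipse: the curve together with its interior. -/
def filled (E : Ellipse) : Set Plane :=
  {p | (E.majorCoord p / E.a) ^ 2 + (E.minorCoord p / E.b) ^ 2 ≤ 1}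

/-- The length of the major axis. -/
def majorAxis (E : Ellipse) : ℝ := 2 * E.a

/-- The eccentricity `√(1 - b² / a²)`; it is `0` exactly for circles. -/
noncomputable def eccentricity (E : Ellipse) : ℝ := Real.sqrt (1 - (E.b / E.a) ^ 2)

end Ellipse

/-! The 2-subdivision splits into three independent sets in cyclic order, with labels `m`, `n` such
that x and a vertex y of the next set are adjacent iff `m x = n y` (`exists_labels_twoSubdivision`).
It remains to realise the complement of such a graph.

Start from three mutually tangent circles of radius 1/2, one per set. Each vertex receives a
perturbation of its circle, a `conic` with parameters g, h proportional to m, n. The perturbing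
factor vanishes on the chord through the two contact points, where the term δ² leaves two points
common to the whole cluster; hence curves of one cluster meet. To first order in δ, g governs the
curve at the contact with the next cluster and h at the contact with the previous one.

At a contact, rescale the normal by δ² and the tangent by δ. In the limit the two filled regions are
x + y² + 1 + gy ≤ 0 and -x + y² + 1 - h'y ≤ 0, which meet iff 2y² + (g - h')y + 2 ≤ 0 for some y.
This fails for g = h' and holds strictly once (g - h')² > 16. `eventually_disjoint` and
`eventually_exists_crossing` transfer this to small δ > 0; finiteness gives one δ for all pairs. -/

open Filter Topology

/-! ### Coordinates of the three clusters -/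

/-- The conic through which all curves of a cluster are described, in coordinates centered at the
center of the unperturbed circle of radius `1/2`. -/
noncomputable def conic (δ g h : ℝ) (q : ℝ × ℝ) : ℝ :=
  q.1 ^ 2 + q.2 ^ 2 - 1 / 4 + δ ^ 2 + δ * (q.1 - √3 / 4) * (g - h - 4 * (g + h) * q.2)

/-- The rotation of order three that carries the coordinates of a cluster to those of the next. -/
noncomputable def turn (q : ℝ × ℝ) : ℝ × ℝ :=
  (√3 / 2 - q.1 / 2 + √3 / 2 * q.2, 1 / 2 - √3 / 2 * q.1 - q.2 / 2)

/-- The coordinates of the `i`-th cluster. -/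
noncomputable def frame (i : Fin 3) (p : Plane) : ℝ × ℝ := turn^[i] (p 0, p 1)

theorem sq_sqrt_three : √3 ^ 2 = 3 := Real.sq_sqrt (by norm_num)

theorem turn_turn_turn (q : ℝ × ℝ) : turn (turn (turn q)) = q := by
  have h := sq_sqrt_three
  ext
  · simp only [turn]
    linear_combination (-√3 / 8 - √3 * q.2 / 8 + 3 / 8 * q.1) * h
  · simp only [turn]
    linear_combination (-(1 - 3 * q.2) / 8 + √3 * q.1 / 8) * h

theorem frame_add_one (i : Fin 3) (p : Plane) : frame (i + 1) p = turn (frame i p) := by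
  fin_cases i
  · rfl
  · rfl
  · exact (turn_turn_turn _).symm

theorem frame_surjective (i : Fin 3) : Function.Surjective (frame i) := by
  have h0 : Function.Surjective (frame 0) := fun q => ⟨!₂[q.1, q.2], by simp [frame]⟩
  have hs : ∀ j, Function.Surjective (frame j) → Function.Surjective (frame (j + 1)) := by
    intro j hj q
    obtain ⟨p, hp⟩ := hj (turn (turn q))
    exact ⟨p, by rw [frame_add_one, hp, turn_turn_turn]⟩
  fin_cases i
  · exact h0
  · exact hs 0 h0
  · exact hs 1 (hs 0 h0)

theorem frame_eq_rigid (i : Fin 3) : ∃ e₀ e₁ s t : ℝ, e₀ ^ 2 + e₁ ^ 2 = 1 ∧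
    ∀ p : Plane, frame i p = (e₀ * p 0 + e₁ * p 1 + s, e₀ * p 1 - e₁ * p 0 + t) := by
  have h := sq_sqrt_three
  fin_cases i
  · exact ⟨1, 0, 0, 0, by norm_num, fun p => by simp [frame]⟩
  · refine ⟨-1 / 2, √3 / 2, √3 / 2, 1 / 2, by linear_combination h / 4, fun p => ?_⟩
    ext
    · simp [frame, turn]; ring
    · simp [frame, turn]; ring
  · refine ⟨-1 / 2, -√3 / 2, √3 / 2, -1 / 2, by linear_combination h / 4, fun p => ?_⟩
    ext
    · simp [frame, turn]
      linear_combination (-p 0 / 4) * h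
    · simp [frame, turn]
      linear_combination (-p 1 / 4 - 1 / 4) * h

/-! ### The conics as nearly circular ellipses -/

/-- The form u² + v² - 2γuv is diagonal along u = v and u = -v, with eigenvalues 1 - γ and 1 + γ. So
the axes lie at 45° to the frame, and γ ≥ 0 makes u = v the major one. -/
theorem exists_ellipse_of_conic {e₀ e₁ : ℝ} (he : e₀ ^ 2 + e₁ ^ 2 = 1) (s t u₀ v₀ : ℝ)
    {γ ρ : ℝ} (hγ : 0 ≤ γ) (hγ1 : γ < 1) (hρ : 0 < ρ) :
    ∃ E : Ellipse, E.a = √(ρ / (1 - γ)) ∧ E.b = √(ρ / (1 + γ)) ∧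
      ∀ p, (E.majorCoord p / E.a) ^ 2 + (E.minorCoord p / E.b) ^ 2 =
        ((e₀ * p 0 + e₁ * p 1 + s - u₀) ^ 2 + (e₀ * p 1 - e₁ * p 0 + t - v₀) ^ 2 -
          2 * γ * (e₀ * p 0 + e₁ * p 1 + s - u₀) * (e₀ * p 1 - e₁ * p 0 + t - v₀)) / ρ := by
  have h2 : √2 ^ 2 = (2 : ℝ) := Real.sq_sqrt (by norm_num)
  have h2' : (√2)⁻¹ ^ 2 = (1 / 2 : ℝ) := by rw [inv_pow, h2]; norm_num
  have h1γ : 0 < 1 - γ := by linarith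
  have h1γ' : 0 < 1 + γ := by linarith
  refine ⟨⟨!₂[(u₀ - s) * e₀ - (v₀ - t) * e₁, (u₀ - s) * e₁ + (v₀ - t) * e₀],
    !₂[(e₀ - e₁) * (√2)⁻¹, (e₁ + e₀) * (√2)⁻¹], √(ρ / (1 - γ)), √(ρ / (1 + γ)), ?_, ?_, ?_⟩,
    rfl, rfl, fun p => ?_⟩
  · rw [EuclideanSpace.norm_eq, Real.sqrt_eq_one]
    simp only [Fin.sum_univ_two, Real.norm_eq_abs, sq_abs]
    simp only [Matrix.cons_val_zero, Matrix.cons_val_one]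
    linear_combination 2 * (√2)⁻¹ ^ 2 * he + 2 * h2'
  · positivity
  · apply Real.sqrt_le_sqrt
    gcongr
    linarith
  · simp only [div_pow, Ellipse.majorCoord, Ellipse.minorCoord]
    rw [Real.sq_sqrt (by positivity), Real.sq_sqrt (by positivity)]
    simp only [Matrix.cons_val_zero, Matrix.cons_val_one]
    set U := e₀ * p 0 + e₁ * p 1 + s - u₀ with hU
    set W := e₀ * p 1 - e₁ * p 0 + t - v₀ with hW
    have hmaj : (e₀ - e₁) * (√2)⁻¹ * (p 0 - ((u₀ - s) * e₀ - (v₀ - t) * e₁)) +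
        (e₁ + e₀) * (√2)⁻¹ * (p 1 - ((u₀ - s) * e₁ + (v₀ - t) * e₀)) = (U + W) * (√2)⁻¹ := by
      rw [hU, hW]
      linear_combination (√2)⁻¹ * (-(u₀ - s) - (v₀ - t)) * he
    have hmin : (e₀ - e₁) * (√2)⁻¹ * (p 1 - ((u₀ - s) * e₁ + (v₀ - t) * e₀)) -
        (e₁ + e₀) * (√2)⁻¹ * (p 0 - ((u₀ - s) * e₀ - (v₀ - t) * e₁)) = (W - U) * (√2)⁻¹ := by
      rw [hU, hW]
      linear_combination (√2)⁻¹ * ((u₀ - s) - (v₀ - t)) * he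
    rw [hmaj, hmin, mul_pow, mul_pow, h2']
    field_simp
    ring

/-- For small `δ` the conics of a cluster bound ellipses that are nearly circles of diameter one. -/
theorem eventually_exists_ellipse (i : Fin 3) {g h ε : ℝ} (hg : 0 ≤ g) (hh : 0 ≤ h) (hε : 0 < ε) :
    ∀ᶠ δ in 𝓝[>] (0 : ℝ), ∃ E : Ellipse,
      E.filled = {p | conic δ g h (frame i p) ≤ 0} ∧
      E.hollow = {p | conic δ g h (frame i p) = 0} ∧
      E.eccentricity < ε ∧ |E.majorAxis - 1| < ε := by
  obtain ⟨e₀, e₁, s, t, he, hf⟩ := frame_eq_rigid i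
  set γ : ℝ → ℝ := fun δ => 2 * δ * (g + h) with hγ
  -- The point (u₀, v₀) is the critical point of the conic, that is, its center; -ρ is the value of
  -- the conic there.
  set u₀ : ℝ → ℝ := fun δ =>
    -(γ δ ^ 2 * (√3 / 4) + δ * (g - h) / 2) / (1 - γ δ ^ 2) with hu
  set v₀ : ℝ → ℝ := fun δ => γ δ * (u₀ δ - √3 / 4) with hv
  set ρ : ℝ → ℝ := fun δ => 1 / 4 - δ ^ 2 + δ * (g - h) * (√3 / 4) -
    (δ * (g - h) * u₀ δ + 2 * γ δ * (√3 / 4) * v₀ δ) / 2 with hρ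
  have cγ : ContinuousAt γ 0 := by fun_prop
  have γ0 : γ 0 = 0 := by simp [hγ]
  have cu : ContinuousAt u₀ 0 := by
    apply ContinuousAt.div (by fun_prop) (by fun_prop)
    simp [γ0]
  have cv : ContinuousAt v₀ 0 := by fun_prop
  have cρ : ContinuousAt ρ 0 := by fun_prop
  have ρ0 : ρ 0 = 1 / 4 := by simp [hρ, γ0]
  have ca : ContinuousAt (fun δ => √(ρ δ / (1 - γ δ))) 0 :=
    (cρ.div (by fun_prop) (by simp [γ0])).sqrt
  have cb : ContinuousAt (fun δ => √(ρ δ / (1 + γ δ))) 0 :=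
    (cρ.div (by fun_prop) (by simp [γ0])).sqrt
  have s4 : √(1 / 4 : ℝ) = 1 / 2 := by
    rw [Real.sqrt_eq_iff_mul_self_eq (by norm_num) (by norm_num)]; norm_num
  have a0 : √(ρ 0 / (1 - γ 0)) = 1 / 2 := by rw [ρ0, γ0, sub_zero, div_one, s4]
  have b0 : √(ρ 0 / (1 + γ 0)) = 1 / 2 := by rw [ρ0, γ0, add_zero, div_one, s4]
  have cecc : ContinuousAt
      (fun δ => √(1 - (√(ρ δ / (1 + γ δ)) / √(ρ δ / (1 - γ δ))) ^ 2)) 0 := by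
    refine ContinuousAt.sqrt (continuousAt_const.sub ((cb.div ca ?_).pow 2))
    rw [a0]; norm_num
  have cmaj : ContinuousAt (fun δ => |2 * √(ρ δ / (1 - γ δ)) - 1|) 0 :=
    ((continuousAt_const.mul ca).sub continuousAt_const).abs
  have E1 : ∀ᶠ δ in 𝓝 (0 : ℝ), γ δ < 1 := cγ.eventually_lt_const (by rw [γ0]; norm_num)
  have E2 : ∀ᶠ δ in 𝓝 (0 : ℝ), 0 < ρ δ := cρ.eventually_const_lt (by rw [ρ0]; norm_num)
  have E3 := cecc.eventually_lt_const (u := ε) (by simpa only [a0, b0, div_self (one_div_ne_zero (two_ne_zero' ℝ)), one_pow, sub_self,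
      Real.sqrt_zero] using hε)
  have E4 := cmaj.eventually_lt_const (u := ε) (by simpa only [a0, mul_one_div_cancel (two_ne_zero' ℝ), sub_self, abs_zero]
      using hε)
  filter_upwards [self_mem_nhdsWithin, nhdsWithin_le_nhds E1, nhdsWithin_le_nhds E2,
    nhdsWithin_le_nhds E3, nhdsWithin_le_nhds E4] with δ hδ h1 h2 h3 h4
  have hδ : 0 < δ := hδ
  have hγ0 : 0 ≤ γ δ := by simp only [hγ]; positivity
  obtain ⟨E, Ea, Eb, hE⟩ := exists_ellipse_of_conic he s t (u₀ δ) (v₀ δ) hγ0 h1 h2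
  have key : ∀ p, (E.majorCoord p / E.a) ^ 2 + (E.minorCoord p / E.b) ^ 2 =
      1 + conic δ g h (frame i p) / ρ δ := by
    intro p
    rw [hE, hf, div_eq_iff h2.ne', add_mul, div_mul_cancel₀ _ h2.ne', one_mul]
    generalize e₀ * p 0 + e₁ * p 1 + s = u
    generalize e₀ * p 1 - e₁ * p 0 + t = v
    have hu' : u₀ δ * (1 - γ δ ^ 2) = -(γ δ ^ 2 * (√3 / 4) + δ * (g - h) / 2) := by
      have : (1 - γ δ ^ 2) ≠ 0 := by nlinarith
      simp only [hu]
      field_simp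
    have hρ' : ρ δ = 1 / 4 - δ ^ 2 + δ * (g - h) * (√3 / 4) -
      (δ * (g - h) * u₀ δ + 2 * γ δ * (√3 / 4) * v₀ δ) / 2 := rfl
    have hv' : v₀ δ = γ δ * (u₀ δ - √3 / 4) := rfl
    have hγ' : γ δ = 2 * δ * (g + h) := rfl
    simp only [conic]
    rw [hρ', hv']
    generalize u₀ δ = a at *
    have hc : δ * (u - √3 / 4) * (g - h - 4 * (g + h) * v) =
      δ * (g - h) * (u - √3 / 4) - 2 * γ δ * v * (u - √3 / 4) := by rw [hγ']; ring
    rw [hc]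
    generalize γ δ = c at *
    linear_combination (a - 2 * u) * hu'
  refine ⟨E, ?_, ?_, ?_, ?_⟩
  · ext p
    simp only [Ellipse.filled, Set.mem_ofPred_eq, key]
    rw [add_le_iff_nonpos_right, div_le_iff₀ h2, zero_mul]
  · ext p
    simp only [Ellipse.hollow, Set.mem_ofPred_eq, key]
    rw [add_eq_left, div_eq_zero_iff, or_iff_left h2.ne']
  · rw [Ellipse.eccentricity, Ea, Eb]; exact h3
  · rw [Ellipse.majorAxis, Ea]; exact h4

/-- The curve is the image of ℝ under the angular parametrization. Connectedness allows an
intermediate value argument along the curve, from inside another ellipse to outside it. -/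
theorem Ellipse.isPreconnected_hollow (E : Ellipse) : IsPreconnected E.hollow := by
  have ha : E.a ≠ 0 := (E.b_pos.trans_le E.b_le_a).ne'
  have hb : E.b ≠ 0 := E.b_pos.ne'
  have hd : E.dir 0 ^ 2 + E.dir 1 ^ 2 = 1 := by
    have := E.norm_dir
    rw [EuclideanSpace.norm_eq, Real.sqrt_eq_one] at this
    simpa [Fin.sum_univ_two] using this
  let f : ℝ → Plane := fun θ =>
    !₂[E.center 0 + E.a * Real.cos θ * E.dir 0 - E.b * Real.sin θ * E.dir 1,
      E.center 1 + E.a * Real.cos θ * E.dir 1 + E.b * Real.sin θ * E.dir 0]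
  have hf : Continuous f := by fun_prop
  have : E.hollow = Set.range f := by
    ext p
    constructor
    · intro hp
      have hp : (E.majorCoord p / E.a) ^ 2 + (E.minorCoord p / E.b) ^ 2 = 1 := hp
      set z : ℂ := ⟨E.majorCoord p / E.a, E.minorCoord p / E.b⟩ with hz
      have hn : ‖z‖ = 1 := by
        rw [Complex.norm_eq_sqrt_sq_add_sq, Real.sqrt_eq_one]; exact hp
      have hz0 : z ≠ 0 := by intro h; simp [h] at hn
      have hc : Real.cos z.arg = E.majorCoord p / E.a := by
        rw [Complex.cos_arg hz0, hn, div_one]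
      have hs : Real.sin z.arg = E.minorCoord p / E.b := by
        rw [Complex.sin_arg, hn, div_one]
      refine ⟨z.arg, ?_⟩
      ext j
      fin_cases j
      · simp only [f, hc, hs, mul_div_cancel₀ _ ha, mul_div_cancel₀ _ hb]
        simp [Ellipse.majorCoord, Ellipse.minorCoord]
        linear_combination (p 0 - E.center 0) * hd
      · simp only [f, hc, hs, mul_div_cancel₀ _ ha, mul_div_cancel₀ _ hb]
        simp [Ellipse.majorCoord, Ellipse.minorCoord]
        linear_combination (p 1 - E.center 1) * hd
    · rintro ⟨θ, rfl⟩
      have h1 : E.majorCoord (f θ) = E.a * Real.cos θ := by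
        simp [Ellipse.majorCoord, f]
        linear_combination (E.a * Real.cos θ) * hd
      have h2 : E.minorCoord (f θ) = E.b * Real.sin θ := by
        simp [Ellipse.minorCoord, f]
        linear_combination (E.b * Real.sin θ) * hd
      simp only [Ellipse.hollow, Set.mem_ofPred_eq, h1, h2, mul_div_cancel_left₀ _ ha,
        mul_div_cancel_left₀ _ hb, Real.cos_sq_add_sin_sq]
  rw [this]
  exact isPreconnected_range hf

/-! ### The contact between consecutive clusters -/

/-- The point near the contact with the next cluster, in coordinates along the common normal and
the common tangent. -/
noncomputable def contactPoint (X Y : ℝ) : ℝ × ℝ :=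
  (√3 / 2 * (1 / 2 + X) + Y / 2, √3 / 2 * Y - (1 / 2 + X) / 2)

theorem exists_contactPoint_eq (q : ℝ × ℝ) : ∃ X Y, contactPoint X Y = q := by
  refine ⟨√3 / 2 * q.1 - q.2 / 2 - 1 / 2, q.1 / 2 + √3 / 2 * q.2, ?_⟩
  ext
  · simp only [contactPoint]
    linear_combination q.1 / 4 * sq_sqrt_three
  · simp only [contactPoint]
    linear_combination q.2 / 4 * sq_sqrt_three

theorem conic_contactPoint (δ g h X Y : ℝ) : conic δ g h (contactPoint X Y) =
    X ^ 2 + X + Y ^ 2 + δ ^ 2 +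
      δ * (√3 * X + Y) * (g - (g + h) * (√3 * Y - X)) := by
  simp only [conic, contactPoint]
  linear_combination ((1 / 2 + X) ^ 2 / 4 + Y ^ 2 / 4) * sq_sqrt_three

/-- Compared with `conic_contactPoint`, the reflection X ↦ -X exchanges the two circles, and the
roles of g and h swap with a change of sign: here h governs the contact. -/
theorem conic_turn_contactPoint (δ g h X Y : ℝ) :
    conic δ g h (turn (contactPoint X Y)) =
    X ^ 2 - X + Y ^ 2 + δ ^ 2 +
      δ * (√3 * X - Y) * (h - (g + h) * (X + √3 * Y)) := by
  have : turn (contactPoint X Y) =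
      (√3 / 2 * (1 / 2 - X) + Y / 2, (1 / 2 - X) / 2 - √3 / 2 * Y) := by
    ext
    · simp only [turn, contactPoint]
      linear_combination (Y / 4) * sq_sqrt_three
    · simp only [turn, contactPoint]
      linear_combination (-(1 / 2 + X) / 4) * sq_sqrt_three
  rw [this]
  simp only [conic]
  linear_combination ((1 / 2 - X) ^ 2 / 4 + Y ^ 2 / 4) * sq_sqrt_three

theorem abs_mul_le_of_sq_add_sq {a b c : ℝ} (h : a ^ 2 + b ^ 2 = 4 * c) : |a * b| ≤ 2 * c := by
  rw [abs_le]
  constructor <;> nlinarith [sq_nonneg (a + b), sq_nonneg (a - b)]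

/-- Matching parameters keep the filled curves of consecutive clusters apart. -/
theorem eventually_disjoint (g h g' : ℝ) : ∀ᶠ δ in 𝓝[>] (0 : ℝ), ∀ q,
    ¬ (conic δ g h q ≤ 0 ∧ conic δ g' g (turn q) ≤ 0) := by
  -- With weights 1 + δw and 1 - δw, this w cancels the terms linear in X from the sum of the two
  -- conics. The only linear term left is of order δ²Y.
  obtain ⟨w, hw⟩ : ∃ w : ℝ, w = -√3 * g := ⟨_, rfl⟩
  obtain ⟨C, hC⟩ : ∃ C : ℝ, C = (2 * |g + h| + 2 * |g' + g|) * (1 + |w|) + |2 * w * g| := ⟨_, rfl⟩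
  have E1 : ∀ᶠ δ in 𝓝 (0 : ℝ), δ * C < 2 :=
    (show ContinuousAt (fun δ : ℝ => δ * C) 0 by fun_prop).eventually_lt_const (by norm_num)
  have E2 : ∀ᶠ δ in 𝓝 (0 : ℝ), δ * |w| < 1 :=
    (show ContinuousAt (fun δ : ℝ => δ * |w|) 0 by fun_prop).eventually_lt_const (by norm_num)
  have E3 : ∀ᶠ δ in 𝓝 (0 : ℝ), δ < 1 := eventually_lt_nhds (by norm_num)
  filter_upwards [self_mem_nhdsWithin, nhdsWithin_le_nhds E1, nhdsWithin_le_nhds E2,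
    nhdsWithin_le_nhds E3] with δ hδ h1 h2 h3
  have hδ : 0 < δ := hδ
  rintro q ⟨hA, hB⟩
  obtain ⟨X, Y, rfl⟩ := exists_contactPoint_eq q
  rw [conic_contactPoint] at hA
  rw [conic_turn_contactPoint] at hB
  -- The weighted sum is 2N plus an error of at most δCN, hence positive once δC < 2. This bound is
  -- uniform over the plane, so points far from the contact need no separate treatment.
  obtain ⟨N, hN⟩ : ∃ N : ℝ, N = X ^ 2 + Y ^ 2 + δ ^ 2 := ⟨_, rfl⟩
  have hN0 : 0 < N := by rw [hN]; positivity
  have hXY : X ^ 2 + Y ^ 2 ≤ N := by rw [hN]; linarith [sq_nonneg δ]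
  obtain ⟨P, hP⟩ : ∃ P : ℝ, P = (√3 * X + Y) * (√3 * Y - X) := ⟨_, rfl⟩
  obtain ⟨Q, hQ⟩ : ∃ Q : ℝ, Q = (√3 * X - Y) * (X + √3 * Y) := ⟨_, rfl⟩
  have hPN : |P| ≤ 2 * N := by
    rw [hP]
    refine (abs_mul_le_of_sq_add_sq (c := X ^ 2 + Y ^ 2) ?_).trans (by linarith)
    linear_combination (X ^ 2 + Y ^ 2) * sq_sqrt_three
  have hQN : |Q| ≤ 2 * N := by
    rw [hQ]
    refine (abs_mul_le_of_sq_add_sq (c := X ^ 2 + Y ^ 2) ?_).trans (by linarith)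
    linear_combination (X ^ 2 + Y ^ 2) * sq_sqrt_three
  have hYN : |δ * Y| ≤ N := by
    rw [abs_le, hN]
    constructor <;> nlinarith [sq_nonneg (δ + Y), sq_nonneg (δ - Y), sq_nonneg X]
  have hδw : |δ * w| ≤ 1 := by rw [abs_mul, abs_of_pos hδ]; exact h2.le
  have hδw' := abs_le.1 hδw
  have hsum : (1 + δ * w) * (X ^ 2 + X + Y ^ 2 + δ ^ 2 +
      δ * (√3 * X + Y) * (g - (g + h) * (√3 * Y - X))) + (1 - δ * w) *
      (X ^ 2 - X + Y ^ 2 + δ ^ 2 + δ * (√3 * X - Y) * (g - (g' + g) * (X + √3 * Y))) =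
      2 * N + δ * (2 * w * g * (δ * Y) - (g + h) * (1 + δ * w) * P -
        (g' + g) * (1 - δ * w) * Q) := by
    rw [hN, hP, hQ, hw]; ring
  have hle : 2 * N + δ * (2 * w * g * (δ * Y) - (g + h) * (1 + δ * w) * P -
        (g' + g) * (1 - δ * w) * Q) ≤ 0 := by
    rw [← hsum]
    exact add_nonpos (mul_nonpos_of_nonneg_of_nonpos (by linarith) hA)
      (mul_nonpos_of_nonneg_of_nonpos (by linarith) hB)
  have hw1 : |1 + δ * w| ≤ 1 + |w| := by
    refine (abs_add_le _ _).trans ?_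
    rw [abs_one, abs_mul, abs_of_pos hδ]
    nlinarith [abs_nonneg w]
  have hw2 : |1 - δ * w| ≤ 1 + |w| := by
    refine (abs_sub _ _).trans ?_
    rw [abs_one, abs_mul, abs_of_pos hδ]
    nlinarith [abs_nonneg w]
  have hR : |2 * w * g * (δ * Y) - (g + h) * (1 + δ * w) * P -
        (g' + g) * (1 - δ * w) * Q| ≤ C * N := by
    calc _ ≤ |2 * w * g * (δ * Y)| + |(g + h) * (1 + δ * w) * P| +
          |(g' + g) * (1 - δ * w) * Q| :=
          (abs_sub _ _).trans (by gcongr; exact abs_sub _ _)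
      _ = |2 * w * g| * |δ * Y| + |g + h| * |1 + δ * w| * |P| +
          |g' + g| * |1 - δ * w| * |Q| := by
          rw [abs_mul (2 * w * g), abs_mul _ P, abs_mul _ Q, abs_mul (g + h), abs_mul (g' + g)]
      _ ≤ |2 * w * g| * N + |g + h| * (1 + |w|) * (2 * N) +
          |g' + g| * (1 + |w|) * (2 * N) := by gcongr
      _ = C * N := by rw [hC]; ring
  have hlow := mul_le_mul_of_nonneg_left (abs_le.1 hR).1 hδ.le
  have hup := mul_lt_mul_of_pos_right h1 hN0
  linarith

/-- All curves of a cluster pass through a common point. -/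
theorem conic_chord_eq_zero {δ : ℝ} (g h : ℝ) (hδ : δ ^ 2 ≤ 1 / 16) :
    conic δ g h (√3 / 4, √(1 / 16 - δ ^ 2)) = 0 := by
  simp only [conic]
  rw [Real.sq_sqrt (by linarith)]
  linear_combination (1 / 16 : ℝ) * sq_sqrt_three

/-- As δ → 0 the point tends to the contact with the previous cluster, which lies strictly outside
the circle of the next one. -/
theorem eventually_conic_turn_pos (g h : ℝ) : ∀ᶠ δ in 𝓝[>] (0 : ℝ),
    0 < conic δ g h (turn (√3 / 4, √(1 / 16 - δ ^ 2))) := by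
  have hc : ContinuousAt
      (fun δ : ℝ => conic δ g h (turn (√3 / 4, √(1 / 16 - δ ^ 2)))) 0 := by
    simp only [conic, turn]
    fun_prop
  refine nhdsWithin_le_nhds (hc.eventually_const_lt ?_)
  have : √(1 / 16 : ℝ) = 1 / 4 := by
    rw [Real.sqrt_eq_iff_mul_self_eq (by norm_num) (by norm_num)]; norm_num
  simp only [conic, turn, ne_eq, OfNat.ofNat_ne_zero, not_false_eq_true, zero_pow, sub_zero,
    this]
  nlinarith [sq_sqrt_three]

/-- Parameters that differ much make the curve of a cluster enter that of the next one. -/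
theorem eventually_exists_crossing {g h g' h' : ℝ} (hgh : 16 < (g - h') ^ 2) :
    ∀ᶠ δ in 𝓝[>] (0 : ℝ), ∃ q, conic δ g h q = 0 ∧ conic δ g' h' (turn q) < 0 := by
  -- This y minimizes 2y² + (g - h')y + 2, with minimum 2 - (g - h')²/8 < 0. `A` and `B` are the two
  -- conics at (δ²x, δy), divided by δ².
  set y : ℝ := -(g - h') / 4 with hy
  set A : ℝ → ℝ → ℝ := fun δ x => δ ^ 2 * x ^ 2 + x + y ^ 2 + 1 +
    (√3 * δ * x + y) * (g - (g + h) * δ * (√3 * y - δ * x)) with hA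
  set B : ℝ → ℝ → ℝ := fun δ x => δ ^ 2 * x ^ 2 - x + y ^ 2 + 1 +
    (√3 * δ * x - y) * (h' - (g' + h') * δ * (δ * x + √3 * y)) with hB
  -- At δ = 0, `A` is x - a and `B` is b - x. For small δ, `A` therefore changes sign between (a +
  -- b)/2 and a + 1, while `B` stays negative there, uniformly by compactness.
  set a : ℝ := -(y ^ 2 + g * y + 1) with ha
  set b : ℝ := y ^ 2 - h' * y + 1 with hb
  have hab : b < a := by rw [ha, hb, hy]; nlinarith
  have EB : ∀ᶠ δ in 𝓝 (0 : ℝ), ∀ x ∈ Set.Icc ((a + b) / 2) (a + 1), B δ x < 0 := by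
    refine isCompact_Icc.eventually_forall_of_forall_eventually fun x hx => ?_
    have : Continuous fun z : ℝ × ℝ => B z.1 z.2 := by simp only [hB]; fun_prop
    refine this.continuousAt.eventually_lt_const ?_
    have := hx.1
    simp only [hB]
    linarith
  have EA : ∀ᶠ δ in 𝓝 (0 : ℝ), A δ ((a + b) / 2) < 0 := by
    have : Continuous fun δ : ℝ => A δ ((a + b) / 2) := by simp only [hA]; fun_prop
    refine this.continuousAt.eventually_lt_const ?_
    simp only [hA]
    linarith
  have EA' : ∀ᶠ δ in 𝓝 (0 : ℝ), 0 < A δ (a + 1) := by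
    have : Continuous fun δ : ℝ => A δ (a + 1) := by simp only [hA]; fun_prop
    refine this.continuousAt.eventually_const_lt ?_
    simp only [hA]
    linarith
  filter_upwards [self_mem_nhdsWithin, nhdsWithin_le_nhds EB, nhdsWithin_le_nhds EA,
    nhdsWithin_le_nhds EA'] with δ hδ h1 h2 h3
  have hδ : 0 < δ := hδ
  have hc : Continuous (A δ) := by simp only [hA]; fun_prop
  obtain ⟨x, hx, hx0⟩ := intermediate_value_Icc (show (a + b) / 2 ≤ a + 1 by linarith)
    hc.continuousOn ⟨h2.le, h3.le⟩
  refine ⟨contactPoint (δ ^ 2 * x) (δ * y), ?_, ?_⟩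
  · rw [conic_contactPoint]
    have : δ ^ 2 * A δ x = 0 := by rw [hx0, mul_zero]
    rw [← this]
    simp only [hA]
    ring
  · rw [conic_turn_contactPoint]
    have : δ ^ 2 * B δ x < 0 := mul_neg_of_pos_of_neg (by positivity) (h1 x hx)
    convert this using 1
    simp only [hB]
    ring

theorem continuous_frame (i : Fin 3) : Continuous (frame i) := by
  obtain ⟨e₀, e₁, s, t, -, hf⟩ := frame_eq_rigid i
  rw [funext hf]
  fun_prop

theorem continuous_conic (δ g h : ℝ) : Continuous (conic δ g h) := by
  unfold conic
  fun_prop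

/-! ### From labels to intersection graphs -/

/-- Near-circular ellipses in three clusters: those in consecutive clusters are disjoint
exactly when their parameters match, and those in the same cluster meet. -/
theorem exists_ellipses_of_labels {ι : Type*} [Finite ι] (i : ι → Fin 3) (m n : ι → ℕ) {ε : ℝ}
    (hε : 0 < ε) : ∃ E : ι → Ellipse,
      (∀ x, (E x).eccentricity < ε ∧ |(E x).majorAxis - 1| < ε) ∧
      (∀ x y, i x = i y → ((E x).hollow ∩ (E y).hollow).Nonempty) ∧
      (∀ x y, i y = i x + 1 → m x ≠ n y → ((E x).hollow ∩ (E y).hollow).Nonempty) ∧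
      (∀ x y, i y = i x + 1 → m x = n y → ¬((E x).filled ∩ (E y).filled).Nonempty) := by
  have H1 : ∀ᶠ δ in 𝓝[>] (0 : ℝ), ∀ x, ∃ E : Ellipse,
      E.filled = {p | conic δ (5 * m x) (5 * n x) (frame (i x) p) ≤ 0} ∧
      E.hollow = {p | conic δ (5 * m x) (5 * n x) (frame (i x) p) = 0} ∧
      E.eccentricity < ε ∧ |E.majorAxis - 1| < ε :=
    eventually_all.2 fun x => eventually_exists_ellipse _ (by positivity) (by positivity) hε
  have H2 : ∀ᶠ δ in 𝓝[>] (0 : ℝ), ∀ x y, m x = n y → ∀ q,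
      ¬ (conic δ (5 * m x) (5 * n x) q ≤ 0 ∧ conic δ (5 * m y) (5 * n y) (turn q) ≤ 0) := by
    refine eventually_all.2 fun x => eventually_all.2 fun y => ?_
    by_cases hxy : m x = n y
    · filter_upwards [eventually_disjoint (5 * m x) (5 * n x) (5 * m y)] with δ h _
      rwa [← hxy]
    · exact Eventually.of_forall fun _ h => absurd h hxy
  have H3 : ∀ᶠ δ in 𝓝[>] (0 : ℝ), ∀ x y, m x ≠ n y → ∃ q,
      conic δ (5 * m x) (5 * n x) q = 0 ∧ conic δ (5 * m y) (5 * n y) (turn q) < 0 := by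
    refine eventually_all.2 fun x => eventually_all.2 fun y => ?_
    by_cases hxy : m x = n y
    · exact Eventually.of_forall fun _ h => absurd hxy h
    -- Distinct natural labels differ by at least 1, so the factor 5 gives a square of at least 25.
    · have : 16 < (5 * (m x : ℝ) - 5 * n y) ^ 2 := by
        have h1 : (1 : ℤ) ≤ |(m x : ℤ) - n y| := Int.one_le_abs (by omega)
        have h2 : (1 : ℝ) ≤ |(m x : ℝ) - n y| := by exact_mod_cast h1
        rw [← mul_sub, mul_pow, ← sq_abs ((m x : ℝ) - n y)]
        nlinarith
      filter_upwards [eventually_exists_crossing (h := 5 * n x) (g' := 5 * m y) this] with δ h _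
      exact h
  have H4 : ∀ᶠ δ in 𝓝[>] (0 : ℝ), ∀ y,
      0 < conic δ (5 * m y) (5 * n y) (turn (√3 / 4, √(1 / 16 - δ ^ 2))) :=
    eventually_all.2 fun y => eventually_conic_turn_pos _ _
  have H5 : ∀ᶠ δ in 𝓝[>] (0 : ℝ), δ ^ 2 < 1 / 16 :=
    nhdsWithin_le_nhds <|
      (show ContinuousAt (fun δ : ℝ => δ ^ 2) 0 by fun_prop).eventually_lt_const (by norm_num)
  obtain ⟨δ, h1, h2, h3, h4, h5⟩ := (H1.and (H2.and (H3.and (H4.and H5)))).exists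
  choose E hfill hholl hecc hmaj using h1
  refine ⟨E, fun x => ⟨hecc x, hmaj x⟩, fun x y hxy => ?_, fun x y hxy hne => ?_,
    fun x y hxy heq => ?_⟩
  · obtain ⟨p, hp⟩ := frame_surjective (i x) (√3 / 4, √(1 / 16 - δ ^ 2))
    refine ⟨p, ?_, ?_⟩
    · rw [hholl, Set.mem_ofPred_eq, hp]
      exact conic_chord_eq_zero _ _ h5.le
    · rw [hholl, Set.mem_ofPred_eq, ← hxy, hp]
      exact conic_chord_eq_zero _ _ h5.le
  · obtain ⟨q, hq, hq'⟩ := h3 x y hne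
    obtain ⟨p, hp⟩ := frame_surjective (i x) (√3 / 4, √(1 / 16 - δ ^ 2))
    obtain ⟨p', rfl⟩ := frame_surjective (i x) q
    have hpx : p ∈ (E x).hollow := by
      rw [hholl, Set.mem_ofPred_eq, hp]; exact conic_chord_eq_zero _ _ h5.le
    have hpx' : p' ∈ (E x).hollow := by rw [hholl]; exact hq
    have hcont : Continuous fun p => conic δ (5 * m y) (5 * n y) (frame (i y) p) :=
      (continuous_conic _ _ _).comp (continuous_frame _)
    -- The curve of x has a point strictly inside the ellipse of y, namely `p'`, and a point outside
    -- it, the common point `p` of its cluster; so the curves themselves cross.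
    obtain ⟨z, hz, hz0⟩ := (E x).isPreconnected_hollow.intermediate_value hpx' hpx
      hcont.continuousOn (show (0 : ℝ) ∈ Set.Icc _ _ by
        refine ⟨?_, ?_⟩
        · simp only [hxy, frame_add_one]; exact hq'.le
        · simp only [hxy, frame_add_one, hp]; exact (h4 y).le)
    exact ⟨z, hz, by rw [hholl]; exact hz0⟩
  · rintro ⟨p, hx, hy⟩
    rw [hfill, Set.mem_ofPred_eq] at hx hy
    rw [hxy, frame_add_one] at hy
    exact h2 x y heq _ ⟨hx, hy⟩

theorem Ellipse.hollow_subset_filled (E : Ellipse) : E.hollow ⊆ E.filled := fun _ h => le_of_eq h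

theorem intersectionGraph_ellipses_eq_compl {ι : Type*} {H : SimpleGraph ι} {i : ι → Fin 3}
    {m n : ι → ℕ} (hsame : ∀ x y, i x = i y → ¬ H.Adj x y)
    (hnext : ∀ x y, i y = i x + 1 → (H.Adj x y ↔ m x = n y)) {E : ι → Ellipse}
    (h1 : ∀ x y, i x = i y → ((E x).hollow ∩ (E y).hollow).Nonempty)
    (h2 : ∀ x y, i y = i x + 1 → m x ≠ n y → ((E x).hollow ∩ (E y).hollow).Nonempty)
    (h3 : ∀ x y, i y = i x + 1 → m x = n y → ¬((E x).filled ∩ (E y).filled).Nonempty) :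
    intersectionGraph (fun x => (E x).filled) = Hᶜ ∧
      intersectionGraph (fun x => (E x).hollow) = Hᶜ := by
  have hcases : ∀ a b : Fin 3, a = b ∨ b = a + 1 ∨ a = b + 1 := by decide
  have hmeet : ∀ x y, ¬ H.Adj x y → ((E x).hollow ∩ (E y).hollow).Nonempty := by
    intro x y hxy
    rcases hcases (i x) (i y) with h | h | h
    · exact h1 x y h
    · exact h2 x y h fun e => hxy ((hnext x y h).2 e)
    · rw [Set.inter_comm]
      exact h2 y x h fun e => hxy ((hnext y x h).2 e).symm
  have hdisj : ∀ x y, H.Adj x y → ¬((E x).filled ∩ (E y).filled).Nonempty := by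
    intro x y hxy
    rcases hcases (i x) (i y) with h | h | h
    · exact absurd hxy (hsame x y h)
    · exact h3 x y h ((hnext x y h).1 hxy)
    · rw [Set.inter_comm]
      exact h3 y x h ((hnext y x h).1 hxy.symm)
  have hsub : ∀ x y, ((E x).hollow ∩ (E y).hollow).Nonempty →
      ((E x).filled ∩ (E y).filled).Nonempty := fun x y h =>
    h.mono (Set.inter_subset_inter (E x).hollow_subset_filled (E y).hollow_subset_filled)
  constructor
  · ext x y
    rw [SimpleGraph.compl_adj]
    exact and_congr_right fun _ => ⟨fun h ha => hdisj x y ha h, fun h => hsub x y (hmeet x y h)⟩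
  · ext x y
    rw [SimpleGraph.compl_adj]
    exact and_congr_right fun _ => ⟨fun h ha => hdisj x y ha (hsub x y h), hmeet x y⟩

/-! ### Labels of the 2-subdivision -/

/-- The 2-subdivision splits into three independent sets, arranged cyclically, between which
adjacency is equality of labels. -/
theorem exists_labels_twoSubdivision {V : Type*} [Finite V] (G : SimpleGraph V) :
    ∃ (i : V ⊕ G.Dart → Fin 3) (m n : V ⊕ G.Dart → ℕ),
      (∀ x y, i x = i y → ¬ (twoSubdivision G).Adj x y) ∧
      ∀ x y, i y = i x + 1 → ((twoSubdivision G).Adj x y ↔ m x = n y) := by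
  obtain ⟨f, hf⟩ := exists_injective_nat V
  obtain ⟨k, hk⟩ := exists_injective_nat (Sym2 V)
  let pos : G.Dart → Prop := fun d => f d.fst < f d.snd
  have hpos : ∀ d : G.Dart, pos d.symm ↔ ¬ pos d := by
    intro d
    have : f d.fst ≠ f d.snd := fun h => d.fst_ne_snd (hf h)
    change f d.snd < f d.fst ↔ ¬ f d.fst < f d.snd
    omega
  classical
  -- The classes are the original vertices, the darts that increase `f`, and those that decrease it.
  -- A dart is matched to its original vertex by the label of its first endpoint and to its reverse
  -- by the label of their edge.
  refine ⟨Sum.elim (fun _ => 0) fun d => if pos d then 1 else 2,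
    Sum.elim f fun d => if pos d then k d.edge else f d.fst,
    Sum.elim f fun d => if pos d then f d.fst else k d.edge, ?_, ?_⟩
  · rintro (u | d) (v | e) h hadj
    · exact hadj
    · by_cases he : pos e <;> simp [he] at h
    · by_cases hd : pos d <;> simp [hd] at h
    · obtain rfl : e = d.symm := hadj
      have := hpos d
      by_cases hd : pos d <;> simp [hd, this] at h
  · rintro (u | d) (v | e) h
    · simp at h
    · by_cases he : pos e
      · simp only [Sum.elim_inl, Sum.elim_inr, if_pos he]
        exact ⟨fun h => congrArg f (Eq.symm h), fun h => (hf h).symm⟩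
      · simp [he] at h
    · by_cases hd : pos d
      · simp [hd] at h
      · simp only [Sum.elim_inl, Sum.elim_inr, if_neg hd]
        exact ⟨fun h => congrArg f h, fun h => hf h⟩
    · by_cases hd : pos d <;> by_cases he : pos e <;> simp [hd, he] at h
      simp only [Sum.elim_inr, if_pos hd, if_neg he]
      change e = d.symm ↔ _
      rw [hk.eq_iff, SimpleGraph.dart_edge_eq_iff]
      constructor
      · rintro rfl
        exact Or.inr d.symm_symm.symm
      · rintro (rfl | rfl)
        · exact absurd hd he
        · exact e.symm_symm.symm

theorem mainTheorem9 {V : Type*} [Finite V] (G : SimpleGraph V) (ε : ℝ) (hε : 0 < ε) :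
    ∃ E : V ⊕ G.Dart → Ellipse,
      intersectionGraph (fun x => (E x).filled) = coTwoSubdivision G ∧
      intersectionGraph (fun x => (E x).hollow) = coTwoSubdivision G ∧
      ∀ x, (E x).eccentricity < ε ∧ |(E x).majorAxis - 1| < ε := by
  obtain ⟨i, m, n, hsame, hnext⟩ := exists_labels_twoSubdivision G
  have : Finite G.Dart := Finite.of_injective _ SimpleGraph.Dart.toProd_injective
  obtain ⟨E, hE, h1, h2, h3⟩ := exists_ellipses_of_labels i m n hε
  obtain ⟨hfilled, hhollow⟩ := intersectionGraph_ellipses_eq_compl hsame hnext h1 h2 h3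
  exact ⟨E, hfilled, hhollow, hE⟩
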